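/- **Theorem (Cographic matroids, PI-OCRS).** Every cographic matroid on a finite ground set admits a $\frac1{12}$-selectable PI-OCRS. Here the terms mean the following. A matroid $M=(E,\mathcal I)$ is *cographic* if it is the dual of the cycle matroid of a multigraph $G$ with edge set $E$ (loops and parallel edges allowed; the independent sets of the cycle matroid are the edge sets containing no cycle). Its matroid polytope is $\mathcal P_M=\{x\in\mathbb R^E : x\ge 0,\ \sum_{i\in S}x_i\le \mathrm{rank}(S)\ \ \forall S\subseteq E\}$. A probability distribution $\mathcal D$ over subsets of $E$ is *PI-consistent* with $x$ if $\Pr_{R\sim\mathcal D}[i\in R]=x_i$ for all $i\in E$ and $\Pr_{R\sim\mathcal D}[\{i,j\}\subseteq R]=x_ix_j$ for all $i\ne j$ in $E$. A *greedy PI-OCRS* for $M$ is a randomized online algorithm which, given $\mathcal D$ and before the items of the random set $R\sim\mathcal D$ arrive, draws (independently of $R$) a random nonempty down-closed family $\mathcal F\subseteq\mathcal I$; it then starts with $I=\varnothing$ and adds each arriving item $e$ to $I$ if and only if $I\cup\{e\}\in\mathcal F$. For $b,c\in[0,1]$ it is *$(b,c)$-selectable* if for every $x\in b\mathcal P_M$,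 every distribution $\mathcal D$ PI-consistent with $x$, and every $i\in E$ with $\Pr[i\in R]>0$, $$\Pr\big[\,I\cup\{i\}\in\mathcal F\ \text{ for all } I\subseteq R \text{ with } I\in\mathcal F\ \big|\ i\in R\,\big]\ \ge\ c,$$ where the probability is over $R\sim\mathcal D$ and the random choice of $\mathcal F$; *$c$-selectable* means $(1,c)$-selectable. Thus: for every cographic matroid $M$ on a finite ground set there is a greedy PI-OCRS for $M$ that is $(1,\frac1{12})$-selectable. -/

import Mathlib

open scoped Pointwise ENNReal

universe u v

noncomputable section

/-! ### Graphic and cographic matroids -/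

namespace Graph

variable {V : Type*} {E : Type*}

/-- `C` is the edge set of a cycle of the multigraph `G`: there are `n + 1 ≥ 1` distinct vertices
`v 0, …, v n` and distinct edges `e 0, …, e n` such that `e i` joins `v i` to `v (i + 1)`, indices
being taken modulo `n + 1`. Loops (`n = 0`) and pairs of parallel edges (`n = 1`) are cycles. -/
def IsCycleEdgeSet (G : Graph V E) (C : Set E) : Prop :=
  ∃ (n : ℕ) (v : Fin (n + 1) → V) (e : Fin (n + 1) → E),
    Function.Injective v ∧ Function.Injective e ∧
      (∀ i, G.IsLink (e i) (v i) (v (i + 1))) ∧ C = Set.range e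

/-- `I` is a set of edges of `G` that contains no cycle, i.e. the edge set of a forest in `G`. -/
def IsForestEdgeSet (G : Graph V E) (I : Set E) : Prop :=
  I ⊆ G.edgeSet ∧ ∀ C ⊆ I, ¬ G.IsCycleEdgeSet C

/-- Incidence vector modulo 2 of an edge: the sum of its two ends (only used to verify the matroid
axioms for the cycle matroid). -/
def incVec (G : Graph V E) (a : E) : V →₀ ZMod 2 :=
  open Classical in
  if h : ∃ p : V × V, G.IsLink a p.1 p.2 then
    Finsupp.single h.choose.1 1 + Finsupp.single h.choose.2 1 else 0

theorem incVec_eq (G : Graph V E) {a : E} {x y : V} (h : G.IsLink a x y) :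
    G.incVec a = Finsupp.single x 1 + Finsupp.single y 1 := by
  have hex : ∃ p : V × V, G.IsLink a p.1 p.2 := ⟨(x, y), h⟩
  rw [incVec, dif_pos hex]
  obtain ⟨h1, h2⟩ | ⟨h1, h2⟩ := h.eq_and_eq_or_eq_and_eq hex.choose_spec
  · rw [← h1, ← h2]
  · rw [← h1, ← h2, add_comm]

theorem not_linearIndepOn_of_isCycleEdgeSet (G : Graph V E) {C I : Set E} (hCI : C ⊆ I)
    (hC : G.IsCycleEdgeSet C) : ¬ LinearIndepOn (ZMod 2) G.incVec I := by
  intro hI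
  obtain ⟨n, v, e, -, he, hl, rfl⟩ := hC
  have hli : LinearIndependent (ZMod 2) (G.incVec ∘ e) :=
    (linearIndepOn_range_iff he G.incVec).1 (hI.mono hCI)
  have h0 : ∑ i, (1 : ZMod 2) • (G.incVec ∘ e) i = 0 := by
    have h1 : ∀ i, (1 : ZMod 2) • (G.incVec ∘ e) i =
        Finsupp.single (v i) 1 + Finsupp.single (v (i + 1)) 1 := by
      intro i
      rw [one_smul, Function.comp_apply, G.incVec_eq (hl i)]
    rw [Finset.sum_congr rfl fun i _ => h1 i, Finset.sum_add_distrib]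
    have h2 : ∑ i, Finsupp.single (v (i + 1)) (1 : ZMod 2) = ∑ i, Finsupp.single (v i) 1 :=
      Equiv.sum_comp (Equiv.addRight (1 : Fin (n + 1))) fun i => Finsupp.single (v i) (1 : ZMod 2)
    rw [h2]
    ext w
    simpa using CharTwo.add_self_eq_zero _
  have := Fintype.linearIndependent_iff.1 hli (fun _ => 1) h0 0
  exact one_ne_zero this

/-- A walk of length `n` from `x` to `y` with edges in `I`. -/
def HasWalk (G : Graph V E) (I : Set E) (x y : V) (n : ℕ) : Prop :=
  ∃ (v : ℕ → V) (e : ℕ → E), v 0 = x ∧ v n = y ∧ ∀ i < n, e i ∈ I ∧ G.IsLink (e i) (v i) (v (i + 1))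

theorem HasWalk.snoc {G : Graph V E} {I : Set E} {x y z : V} {n : ℕ} (h : G.HasWalk I x y n)
    {a : E} (ha : a ∈ I) (hl : G.IsLink a y z) : G.HasWalk I x z (n + 1) := by
  obtain ⟨v, e, h0, hn, hs⟩ := h
  refine ⟨fun k => if k ≤ n then v k else z, fun k => if k < n then e k else a, by simp [h0],
    by simp, fun i hi => ?_⟩
  rcases Nat.lt_succ_iff_lt_or_eq.1 hi with h | rfl
  · have h1 : i ≤ n := h.le
    have h2 : i + 1 ≤ n := h
    simpa [h, h1, h2] using hs i h
  · simpa [hn] using ⟨ha, hl⟩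

/-- A shortest walk between the ends of an edge closes up to a cycle. -/
theorem exists_cycle_of_hasWalk (G : Graph V E) {I : Set E} {x y : V} {a : E} (ha : a ∉ I)
    (hl : G.IsLink a x y) (h : ∃ n, G.HasWalk I x y n) :
    ∃ C ⊆ insert a I, G.IsCycleEdgeSet C := by
  classical
  obtain ⟨v, e, h0, hn, hs⟩ := Nat.find_spec h
  set n := Nat.find h with hdef
  have hinj : ∀ i j, i < j → j ≤ n → v i ≠ v j := by
    intro i j hij hjn heq
    have hlt : n - (j - i) < n := by omega
    refine Nat.find_min h hlt ⟨fun k => if k ≤ i then v k else v (k + (j - i)),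
      fun k => if k < i then e k else e (k + (j - i)), by simp [h0], ?_, ?_⟩
    · by_cases hc : n - (j - i) ≤ i
      · have h1 : j = n := by omega
        have h2 : n - (j - i) = i := by omega
        simp only [h2, le_refl, if_true]
        rw [heq, h1, hn]
      · simp only [hc, if_false]
        rw [Nat.sub_add_cancel (by omega), hn]
    · intro k hk
      rcases lt_trichotomy k i with hki | rfl | hki
      · have h1 : k ≤ i := hki.le
        have h2 : k + 1 ≤ i := hki
        simpa [hki, h1, h2] using hs k (by omega)
      · have h3 := hs j (by omega)
        rw [← heq] at h3
        have h4 : k + (j - k) = j := by omega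
        have h5 : k + 1 + (j - k) = j + 1 := by omega
        simpa [h4, h5] using h3
      · have h1 : ¬ k ≤ i := by omega
        have h2 : ¬ k + 1 ≤ i := by omega
        have h3 : ¬ k < i := by omega
        have h4 : k + 1 + (j - i) = k + (j - i) + 1 := by omega
        simpa [h1, h2, h3, h4] using hs (k + (j - i)) (by omega)
  have hinj' : ∀ i j, i ≤ n → j ≤ n → v i = v j → i = j := by
    intro i j hi hj heq
    rcases lt_trichotomy i j with h | h | h
    · exact absurd heq (hinj i j h hj)
    · exact h
    · exact absurd heq.symm (hinj j i h hi)
  refine ⟨_, ?_, n, fun i => v i, fun i => if (i : ℕ) < n then e i else a, ?_, ?_, ?_, rfl⟩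
  · rintro _ ⟨i, rfl⟩
    by_cases hi : (i : ℕ) < n
    · simpa [hi] using Or.inr (hs i hi).1
    · simp [hi]
  · intro i j hij
    exact Fin.ext (hinj' i j (by omega) (by omega) hij)
  · intro i j hij
    by_cases hi : (i : ℕ) < n <;> by_cases hj : (j : ℕ) < n
    · simp only [hi, hj, if_true] at hij
      have h1 := (hs i hi).2
      have h2 := (hs j hj).2
      rw [hij] at h1
      rcases h1.eq_and_eq_or_eq_and_eq h2 with ⟨h3, -⟩ | ⟨h3, h4⟩
      · exact Fin.ext (hinj' _ _ (by omega) (by omega) h3)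
      · have h5 := hinj' _ _ (by omega) (by omega) h3
        have h6 := hinj' _ _ (by omega) (by omega) h4
        omega
    · simp only [hi, hj, if_true, if_false] at hij
      exact absurd (hij ▸ (hs i hi).1) ha
    · simp only [hi, hj, if_true, if_false] at hij
      exact absurd (hij ▸ (hs j hj).1) ha
    · exact Fin.ext (by omega)
  · intro i
    by_cases hi : (i : ℕ) < n
    · have h1 : ((i + 1 : Fin (n + 1)) : ℕ) = i + 1 := by
        rw [Fin.val_add_one_of_lt]
        exact Fin.lt_def.2 (by simpa using hi)
      simpa [hi, h1] using (hs i hi).2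
    · have h1 : i = Fin.last n := Fin.ext (by simp; omega)
      subst h1
      simpa [h0, hn] using hl.symm

theorem hasWalk_of_mem_span (G : Graph V E) {I : Set E} (hI : I ⊆ G.edgeSet) {x y : V} {a : E}
    (hl : G.IsLink a x y) (h : G.incVec a ∈ Submodule.span (ZMod 2) (G.incVec '' I)) :
    ∃ n, G.HasWalk I x y n := by
  classical
  by_contra hno
  let φ : (V →₀ ZMod 2) →ₗ[ZMod 2] ZMod 2 :=
    Finsupp.linearCombination (ZMod 2) fun w => if ∃ n, G.HasWalk I x w n then (1 : ZMod 2) else 0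
  have hφ : ∀ w, φ (Finsupp.single w 1) = if ∃ n, G.HasWalk I x w n then (1 : ZMod 2) else 0 := by
    intro w
    simp [φ]
  have hker : Submodule.span (ZMod 2) (G.incVec '' I) ≤ LinearMap.ker φ := by
    rw [Submodule.span_le]
    rintro _ ⟨b, hb, rfl⟩
    obtain ⟨u, w, huw⟩ := G.exists_isLink_of_mem_edgeSet (hI hb)
    have hiff : (∃ n, G.HasWalk I x u n) ↔ ∃ n, G.HasWalk I x w n :=
      ⟨fun ⟨n, hn⟩ => ⟨n + 1, hn.snoc hb huw⟩, fun ⟨n, hn⟩ => ⟨n + 1, hn.snoc hb huw.symm⟩⟩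
    rw [SetLike.mem_coe, LinearMap.mem_ker, G.incVec_eq huw, map_add, hφ, hφ]
    simp only [hiff]
    exact CharTwo.add_self_eq_zero _
  have h1 := LinearMap.mem_ker.1 (hker h)
  have hx : ∃ n, G.HasWalk I x x n := ⟨0, fun _ => x, fun _ => a, rfl, rfl, by simp⟩
  rw [G.incVec_eq hl, map_add, hφ, hφ, if_pos hx, if_neg hno] at h1
  simp at h1

theorem IsForestEdgeSet.subset {G : Graph V E} {I J : Set E} (hJ : G.IsForestEdgeSet J)
    (hIJ : I ⊆ J) : G.IsForestEdgeSet I :=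
  ⟨hIJ.trans hJ.1, fun C hC => hJ.2 C (hC.trans hIJ)⟩

theorem isForestEdgeSet_iff (G : Graph V E) {I : Set E} (hfin : I.Finite) :
    G.IsForestEdgeSet I ↔ I ⊆ G.edgeSet ∧ LinearIndepOn (ZMod 2) G.incVec I := by
  refine ⟨fun h => ⟨h.1, ?_⟩,
    fun h => ⟨h.1, fun C hC hc => G.not_linearIndepOn_of_isCycleEdgeSet hC hc h.2⟩⟩
  induction I, hfin using Set.Finite.induction_on with
  | empty => exact linearIndepOn_empty _ _
  | @insert a I ha hfin ih =>
    rw [linearIndepOn_insert ha]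
    refine ⟨ih (h.subset (Set.subset_insert a I)), fun hsp => ?_⟩
    obtain ⟨x, y, hl⟩ := G.exists_isLink_of_mem_edgeSet (h.1 (Set.mem_insert a I))
    obtain ⟨C, hC, hcyc⟩ := G.exists_cycle_of_hasWalk ha hl
      (G.hasWalk_of_mem_span ((Set.subset_insert a I).trans h.1) hl hsp)
    exact h.2 C hC hcyc

theorem IsForestEdgeSet.augment {G : Graph V E} {I J : Set E} (hI : G.IsForestEdgeSet I)
    (hIfin : I.Finite) (hJ : G.IsForestEdgeSet J) (hJfin : J.Finite) (hlt : I.ncard < J.ncard) :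
    ∃ e ∈ J, e ∉ I ∧ G.IsForestEdgeSet (insert e I) := by
  obtain ⟨hIE, hIli⟩ := (G.isForestEdgeSet_iff hIfin).1 hI
  obtain ⟨hJE, hJli⟩ := (G.isForestEdgeSet_iff hJfin).1 hJ
  by_contra! hno
  have hsub : ∀ b ∈ J, G.incVec b ∈ Submodule.span (ZMod 2) (G.incVec '' I) := by
    intro b hb
    by_cases hbI : b ∈ I
    · exact Submodule.subset_span ⟨b, hbI, rfl⟩
    · by_contra hsp
      refine hno b hb hbI ((G.isForestEdgeSet_iff (hIfin.insert b)).2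
        ⟨Set.insert_subset (hJE hb) hIE, (linearIndepOn_insert hbI).2 ⟨hIli, hsp⟩⟩)
  have hle : Submodule.span (ZMod 2) (G.incVec '' J) ≤
      Submodule.span (ZMod 2) (G.incVec '' I) := by
    rw [Submodule.span_le]
    rintro _ ⟨b, hb, rfl⟩
    exact hsub b hb
  have hdim : ∀ {K : Set E}, K.Finite → LinearIndepOn (ZMod 2) G.incVec K →
      Module.finrank (ZMod 2) (Submodule.span (ZMod 2) (G.incVec '' K)) = K.ncard := by
    intro K hK hli
    have := hK.fintype
    rw [Set.image_eq_range, finrank_span_eq_card hli, ← Nat.card_eq_fintype_card,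
      Nat.card_coe_set_eq]
  have : Module.Finite (ZMod 2) (Submodule.span (ZMod 2) (G.incVec '' I)) :=
    Module.Finite.span_of_finite _ (hIfin.image _)
  have := Submodule.finrank_mono hle
  rw [hdim hIfin hIli, hdim hJfin hJli] at this
  omega

/-- The cycle matroid of a multigraph: its ground set is the edge set, and a set of edges is
independent iff it is the edge set of a forest. -/
def cycleMatroid (G : Graph V E) : Matroid E :=
  (IndepMatroid.ofFinitaryCardAugment G.edgeSet G.IsForestEdgeSet
    ⟨Set.empty_subset _, by
      rintro C hC ⟨n, v, e, -, -, -, rfl⟩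
      exact hC (Set.mem_range_self 0)⟩
    (fun _ _ hJ hIJ => hJ.subset hIJ)
    (fun _ _ hI hIf hJ hJf hlt => hI.augment hIf hJ hJf hlt)
    (fun I hI => ⟨fun b hb => (hI {b} (by simpa using hb) (Set.finite_singleton b)).1 rfl, by
      rintro C hC ⟨n, v, e, hv, he, hl, rfl⟩
      exact (hI _ hC (Set.finite_range e)).2 _ subset_rfl ⟨n, v, e, hv, he, hl, rfl⟩⟩)
    (fun _ hI => hI.1)).matroid

@[simp] theorem cycleMatroid_ground (G : Graph V E) : G.cycleMatroid.E = G.edgeSet := rfl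

theorem cycleMatroid_indep_iff (G : Graph V E) {I : Set E} :
    G.cycleMatroid.Indep I ↔ I ⊆ G.edgeSet ∧ ∀ C ⊆ I, ¬ G.IsCycleEdgeSet C := by
  simp [cycleMatroid, IndepMatroid.ofFinitaryCardAugment, IndepMatroid.ofFinitary, IsForestEdgeSet]

end Graph

namespace Matroid

variable {E : Type*}

/-- A matroid is cographic if it is the dual of the cycle matroid of a multigraph (with arbitrary
vertex type; loops and parallel edges are allowed). -/
def IsCographic {E : Type v} (M : Matroid E) : Prop :=
  ∃ (V : Type u) (G : Graph V E), M = G.cycleMatroid✶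

/-- The matroid polytope `{x ∈ ℝ^{M.E} | x ≥ 0, x(S) ≤ rank(S) for all S ⊆ M.E}` of a matroid with
finite ground set. Vectors indexed by the ground set `M.E` are represented as functions on the
ambient type that vanish outside `M.E`. -/
def polytope (M : Matroid E) : Set (E → ℝ) :=
  {x | (∀ i, 0 ≤ x i) ∧ (∀ i ∉ M.E, x i = 0) ∧
    ∀ S : Finset E, (S : Set E) ⊆ M.E → ∑ i ∈ S, x i ≤ ((M.eRk S).toNat : ℝ)}

end Matroid

/-! ### Discrete probability -/

namespace PMF

variable {Ω : Type*}

/-- The probability of an event under a discrete distribution. -/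
def prob (p : PMF Ω) (A : Set Ω) : ℝ := (p.toOuterMeasure A).toReal

/-- The conditional probability `Pr[A | B]`, meaningful if `B` has positive probability. -/
def condProb (p : PMF Ω) (A B : Set Ω) : ℝ := p.prob (A ∩ B) / p.prob B

/-- The joint distribution of two independent random variables with given distributions. -/
def indepProd {Ω' : Type*} (p : PMF Ω) (q : PMF Ω') : PMF (Ω × Ω') :=
  p.bind fun a => q.map fun b => (a, b)

end PMF

/-! ### Pairwise-independent online contention resolution schemes -/

section OCRS

variable {E : Type*}

/-- The distribution `D` of a random set `R` is PI-consistent with `x`: `Pr[i ∈ R] = x i` for all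
`i`, and `Pr[{i, j} ⊆ R] = x i * x j` for all `i ≠ j`. -/
def PIConsistent (D : PMF (Set E)) (x : E → ℝ) : Prop :=
  (∀ i, D.prob {R | i ∈ R} = x i) ∧
    ∀ i j, i ≠ j → D.prob {R | {i, j} ⊆ R} = x i * x j

/-- `F` is a (nonempty) down-closed family of independent sets of `M`. -/
structure IsFeasibleFamily (M : Matroid E) (F : Set (Set E)) : Prop where
  empty_mem : ∅ ∈ F
  down_closed : ∀ I ∈ F, ∀ J ⊆ I, J ∈ F
  indep : ∀ I ∈ F, M.Indep I

/-- A greedy PI-OCRS for the matroid `M`. Before the items arrive, it is given the distribution `D`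
of the random set `R` and draws, independently of `R`, a random feasible family `F`, whose
distribution is `family D`. It then starts with `I = ∅` and adds each arriving item `e` of `R` to
`I` if and only if `I ∪ {e} ∈ F`; hence it is determined by the distribution of `F`. -/
structure GreedyPIOCRS (M : Matroid E) where
  family : PMF (Set E) → PMF (Set (Set E))
  feasible : ∀ D, ∀ F ∈ (family D).support, IsFeasibleFamily M F

/-- A greedy PI-OCRS is `(b, c)`-selectable if for all `x ∈ b • P_M`, all distributions `D`
PI-consistent with `x`, and all elements `i`,
`Pr[I ∪ {i} ∈ F for all I ⊆ R with I ∈ F | i ∈ R] ≥ c`,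
where `R ~ D` and `F` is the independently drawn feasible family. Elements with `Pr[i ∈ R] = 0`
impose no condition. -/
def GreedyPIOCRS.IsSelectable {M : Matroid E} (π : GreedyPIOCRS M) (b c : ℝ) : Prop :=
  ∀ x ∈ b • M.polytope, ∀ D : PMF (Set E), PIConsistent D x →
    ∀ i ∈ M.E, 0 < D.prob {R | i ∈ R} →
      c ≤ (D.indepProd (π.family D)).condProb
        {ω : Set E × Set (Set E) | ∀ I ⊆ ω.1, I ∈ ω.2 → insert i I ∈ ω.2}
        {ω | i ∈ ω.1}

end OCRS

end

/-! The proof has two independent ingredients.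

Rank: in a cographic matroid, a set `T` of pairwise non-parallel non-loops has rank at least `|T| /
3`. Contract the components of `G` minus `T`. The `T`-edges leaving a component form an edge cut,
and a nonempty cut of size one or two would give a loop or a parallel pair of the dual. Hence every
component met by a surviving non-loop edge has degree at least 3, and the number `κ` of these
components satisfies `3κ ≤ 2|T|`. Deleting `T` lowers the graphic rank by at most `κ`, so the dual
rank of `T` is at least `|T| - κ ≥ |T| / 3` (`card_le_three_mul_eRk_dual`).

Scheme: keep one representative of each parallel class of non-loops. By convex duality the rank
bound yields a random independent set `B` containing each representative with probability at least
`1/3` (`exists_pmf_indep`). Draw also a uniform set `S` and allow only elements of `S` whose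
representative lies in `B`, at most one per parallel class. An element `i` of `R` is never blocked
if its representative is in `B`, `i ∈ S`, and no other parallel element of `R` is in `S`. Given `R`,
the last two events together have probability at least `1/2 - m/4`, where `m` counts the other
elements of `R` parallel to `i`. This is linear in `m`, so pairwise independence determines its
average: a parallel class has weight at most 1 in the polytope, which leaves at least `1/4`. The
product is `1/3 · 1/4 = 1/12`. -/

namespace Graph

/-! ### Rank in cographic matroids, via incidence vectors modulo 2 -/

variable {V : Type*} {E : Type*}

theorem incVec_mem_span_of_isBasis (G : Graph V E) {I X : Set E} (hfin : X.Finite)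
    (hI : G.cycleMatroid.IsBasis I X) {b : E} (hb : b ∈ X) :
    G.incVec b ∈ Submodule.span (ZMod 2) (G.incVec '' I) := by
  by_cases hbI : b ∈ I
  · exact Submodule.subset_span ⟨b, hbI, rfl⟩
  by_contra hsp
  have hIfin : I.Finite := hfin.subset hI.subset
  have hli : G.IsForestEdgeSet I := G.cycleMatroid_indep_iff.1 hI.indep
  have h1 : G.IsForestEdgeSet (insert b I) := (G.isForestEdgeSet_iff (hIfin.insert b)).2
    ⟨Set.insert_subset (hI.subset_ground hb) hli.1,
      (linearIndepOn_insert hbI).2 ⟨((G.isForestEdgeSet_iff hIfin).1 hli).2, hsp⟩⟩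
  exact hbI (hI.mem_of_insert_indep hb (G.cycleMatroid_indep_iff.2 h1))

theorem span_image_incVec_of_isBasis (G : Graph V E) {I X : Set E} (hfin : X.Finite)
    (hI : G.cycleMatroid.IsBasis I X) :
    Submodule.span (ZMod 2) (G.incVec '' I) = Submodule.span (ZMod 2) (G.incVec '' X) := by
  refine le_antisymm (Submodule.span_mono (Set.image_mono hI.subset)) ?_
  rw [Submodule.span_le]
  rintro _ ⟨b, hb, rfl⟩
  exact G.incVec_mem_span_of_isBasis hfin hI hb

/-- The cycle matroid is represented over the two-element field by the incidence vectors. -/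
theorem finrank_span_incVec (G : Graph V E) {X : Set E} (hfin : X.Finite) (hX : X ⊆ G.edgeSet) :
    (Module.finrank (ZMod 2) (Submodule.span (ZMod 2) (G.incVec '' X)) : ℕ∞) =
      G.cycleMatroid.eRk X := by
  obtain ⟨I, hI⟩ := G.cycleMatroid.exists_isBasis X hX
  have hIfin : I.Finite := hfin.subset hI.subset
  have hli := ((G.isForestEdgeSet_iff hIfin).1 (G.cycleMatroid_indep_iff.1 hI.indep)).2
  have := hIfin.fintype
  rw [← G.span_image_incVec_of_isBasis hfin hI, Set.image_eq_range, finrank_span_eq_card hli,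
    ← hI.encard_eq_eRk, ← Nat.card_eq_fintype_card, Nat.card_coe_set_eq, hIfin.cast_ncard_eq]

/-- Two vertices are joined by an edge outside `T`. -/
def AdjOff (G : Graph V E) (T : Finset E) (x y : V) : Prop := ∃ a ∉ T, G.IsLink a x y

/-- The classes of `Quot (G.AdjOff T)` are the components of `G` minus `T`. Along a path avoiding
`T` the incidence vectors telescope, since inner vertices occur twice and cancel modulo 2. -/
theorem single_add_single_mem_span (G : Graph V E) (T : Finset E) {x y : V}
    (h : Quot.mk (G.AdjOff T) x = Quot.mk (G.AdjOff T) y) :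
    (Finsupp.single x 1 + Finsupp.single y 1 : V →₀ ZMod 2) ∈
      Submodule.span (ZMod 2) (G.incVec '' (G.edgeSet \ T)) := by
  have h' := Quot.eqvGen_exact h
  clear h
  induction h' with
  | rel x y h =>
    obtain ⟨a, ha, hl⟩ := h
    rw [← G.incVec_eq hl]
    exact Submodule.subset_span ⟨a, ⟨hl.edge_mem, by simpa using ha⟩, rfl⟩
  | refl x =>
    rw [← two_smul (ZMod 2), show (2 : ZMod 2) = 0 from rfl, zero_smul]
    exact zero_mem _
  | symm x y h ih => rwa [add_comm]
  | trans x y z h1 h2 ih1 ih2 =>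
    have h3 := add_mem ih1 ih2
    have h4 : (Finsupp.single y 1 + Finsupp.single y 1 : V →₀ ZMod 2) = 0 := by
      rw [← two_smul (ZMod 2), show (2 : ZMod 2) = 0 from rfl, zero_smul]
    rwa [add_assoc, ← add_assoc (Finsupp.single y 1), h4, zero_add] at h3

/-- In a cographic matroid, a set of pairwise non-parallel non-loops has rank at least a third of
its size. -/
theorem card_le_three_mul_eRk_dual [Finite E] (G : Graph V E) (T : Finset E)
    (hT : ∀ e ∈ T, ∀ f ∈ T, G.cycleMatroid✶.Indep {e, f}) :
    (T.card : ℕ∞) ≤ 3 * G.cycleMatroid✶.eRk T := by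
  classical
  have hTE : (T : Set E) ⊆ G.edgeSet := fun e he => (hT e he e he).subset_ground (by simp)
  have hends : ∀ e : T, ∃ p : V × V, G.IsLink e p.1 p.2 := fun e => by
    obtain ⟨x, y, h⟩ := G.exists_isLink_of_mem_edgeSet (hTE e.2)
    exact ⟨(x, y), h⟩
  choose p hp using hends
  -- Contract the components of `G` minus `T`: `r` is incidence between components and those edges
  -- of `T` that do not become loops, and `𝒦` is the set of components of nonzero degree.
  let q : V → Quot (G.AdjOff T) := Quot.mk _
  let r : Quot (G.AdjOff T) → T → Prop :=
    fun K e => q (p e).1 ≠ q (p e).2 ∧ (K = q (p e).1 ∨ K = q (p e).2)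
  let F : Finset T := Finset.univ.filter fun e => q (p e).1 ≠ q (p e).2
  let 𝒦 : Finset (Quot (G.AdjOff T)) := F.image (fun e => q (p e).1) ∪ F.image fun e => q (p e).2
  have hr𝒦 : ∀ K, K ∈ 𝒦 ↔ ∃ e, r K e := by
    intro K
    simp only [𝒦, F, r, Finset.mem_union, Finset.mem_image, Finset.mem_filter, Finset.mem_univ,
      true_and]
    constructor
    · rintro (⟨e, h, rfl⟩ | ⟨e, h, rfl⟩)
      exacts [⟨e, h, Or.inl rfl⟩, ⟨e, h, Or.inr rfl⟩]
    · rintro ⟨e, h, rfl | rfl⟩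
      exacts [Or.inl ⟨e, h, rfl⟩, Or.inr ⟨e, h, rfl⟩]
  -- The edges incident with `K` form a cut. If there were at most two, the cut would lie in a set
  -- `{e, f}` that is independent in the dual, so some base `B` of the cycle matroid would avoid it;
  -- but a base spans `e` and so must cross the cut.
  have hcut : ∀ K ∈ 𝒦, 3 ≤ (Finset.bipartiteAbove r Finset.univ K).card := by
    intro K hK
    obtain ⟨e, he⟩ := (hr𝒦 K).1 hK
    by_contra! hlt
    have hef : ∃ f : T, ∀ a, r K a → a = e ∨ a = f := by
      have h1 : ((Finset.bipartiteAbove r Finset.univ K).erase e).card ≤ 1 := by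
        rw [Finset.card_erase_of_mem (by simpa [Finset.bipartiteAbove] using he)]
        omega
      have : Nonempty T := ⟨e⟩
      rw [Finset.card_le_one_iff_subset_singleton] at h1
      obtain ⟨f, hf⟩ := h1
      refine ⟨f, fun a ha => ?_⟩
      by_cases hae : a = e
      · exact Or.inl hae
      · exact Or.inr (by simpa using hf (by simpa [Finset.bipartiteAbove, hae] using ha))
    obtain ⟨f, hf⟩ := hef
    obtain ⟨-, B, hB, hdisj⟩ := Matroid.dual_indep_iff_exists'.1 (hT e e.2 f f.2)
    -- `φ` counts modulo 2 the ends lying in `K`. It vanishes on every edge of `B`, hence on the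
    -- span of `B`, yet equals 1 on `e`, which has exactly one end in `K`.
    let φ : (V →₀ ZMod 2) →ₗ[ZMod 2] ZMod 2 :=
      Finsupp.linearCombination (ZMod 2) fun w => if K = q w then (1 : ZMod 2) else 0
    have hφ : ∀ {a x y}, G.IsLink a x y → φ (G.incVec a) =
        (if K = q x then 1 else 0) + (if K = q y then 1 else 0) := by
      intro a x y hl
      rw [G.incVec_eq hl]
      simp [φ]
    have hker : Submodule.span (ZMod 2) (G.incVec '' B) ≤ LinearMap.ker φ := by
      rw [Submodule.span_le]
      rintro _ ⟨b, hb, rfl⟩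
      rw [SetLike.mem_coe, LinearMap.mem_ker]
      have hz : ∀ {x y}, G.IsLink b x y → q x = q y → φ (G.incVec b) = 0 := by
        intro x y hl hxy
        rw [hφ hl, hxy]
        exact CharTwo.add_self_eq_zero _
      by_cases hbT : b ∈ T
      · by_cases hq : q (p ⟨b, hbT⟩).1 = q (p ⟨b, hbT⟩).2
        · exact hz (hp ⟨b, hbT⟩) hq
        · have hbr : ¬ r K ⟨b, hbT⟩ := by
            intro hrb
            suffices h : b ∈ ({(e : E), (f : E)} : Set E) from Set.disjoint_left.1 hdisj h hb
            rcases hf _ hrb with h | h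
            · exact Or.inl (congrArg Subtype.val h)
            · exact Or.inr (congrArg Subtype.val h)
          have hn : ¬ (K = q (p ⟨b, hbT⟩).1 ∨ K = q (p ⟨b, hbT⟩).2) := fun h => hbr ⟨hq, h⟩
          rw [not_or] at hn
          rw [hφ (hp ⟨b, hbT⟩), if_neg hn.1, if_neg hn.2, add_zero]
      · obtain ⟨x, y, hl⟩ := G.exists_isLink_of_mem_edgeSet (hB.subset_ground hb)
        exact hz hl (Quot.sound ⟨b, hbT, hl⟩)
    have h1 := LinearMap.mem_ker.1 (hker (G.incVec_mem_span_of_isBasis (Set.toFinite _)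
      hB.isBasis_ground (hTE e.2)))
    rw [hφ (hp e)] at h1
    rcases he with ⟨hne, rfl | rfl⟩
    · simp [hne] at h1
    · simp [hne.symm] at h1
  -- Double counting of incidences: each edge has at most two end components.
  have hcount : 𝒦.card * 3 ≤ (Finset.univ : Finset T).card * 2 := by
    refine Finset.card_mul_le_card_mul r hcut fun e _ => ?_
    refine (Finset.card_le_card (t := {q (p e).1, q (p e).2}) fun K hK => ?_).trans
      Finset.card_le_two
    have h1 : r K e := by simpa using (Finset.mem_filter.1 hK).2
    simpa using h1.2
  rw [Finset.card_univ, Fintype.card_coe] at hcount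
  -- Modulo `W`, a vertex equals the chosen vertex of its component. One generator per component in
  -- `𝒦` therefore suffices to recover the edges of `T`, and the rank drops by at most `𝒦.card` when
  -- `T` is deleted.
  let W := Submodule.span (ZMod 2) (G.incVec '' (G.edgeSet \ T))
  let S := Submodule.span (ZMod 2) (((𝒦.image fun K => Finsupp.single K.out (1 : ZMod 2)) :
    Finset (V →₀ ZMod 2)) : Set (V →₀ ZMod 2))
  have hWfin : Module.Finite (ZMod 2) W := Module.Finite.span_of_finite _ (Set.toFinite _)
  have hSfin : Module.Finite (ZMod 2) S := Module.Finite.span_of_finite _ (Finset.finite_toSet _)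
  have hsup : Submodule.span (ZMod 2) (G.incVec '' G.edgeSet) ≤ W ⊔ S := by
    rw [Submodule.span_le]
    rintro _ ⟨b, hb, rfl⟩
    by_cases hbT : b ∈ T
    · rw [G.incVec_eq (hp ⟨b, hbT⟩)]
      by_cases hq : q (p ⟨b, hbT⟩).1 = q (p ⟨b, hbT⟩).2
      · exact Submodule.mem_sup_left (G.single_add_single_mem_span T hq)
      · have hmem : ∀ x, q x ∈ 𝒦 → (Finsupp.single x 1 : V →₀ ZMod 2) ∈ W ⊔ S := by
          intro x hx
          have h1 : (Finsupp.single x 1 + Finsupp.single (q x).out 1 : V →₀ ZMod 2) ∈ W :=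
            G.single_add_single_mem_span T (Quot.out_eq (q x)).symm
          have h2 : (Finsupp.single (q x).out 1 : V →₀ ZMod 2) ∈ S :=
            Submodule.subset_span (Finset.mem_coe.2 (Finset.mem_image_of_mem _ hx))
          have h3 := sub_mem (Submodule.mem_sup_left (T := S) h1)
            (Submodule.mem_sup_right (S := W) h2)
          rwa [add_sub_cancel_right] at h3
        exact add_mem (hmem _ ((hr𝒦 _).2 ⟨⟨b, hbT⟩, hq, Or.inl rfl⟩))
          (hmem _ ((hr𝒦 _).2 ⟨⟨b, hbT⟩, hq, Or.inr rfl⟩))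
    · exact Submodule.mem_sup_left (Submodule.subset_span ⟨b, ⟨hb, hbT⟩, rfl⟩)
  have hrank : Module.finrank (ZMod 2) (Submodule.span (ZMod 2) (G.incVec '' G.edgeSet)) ≤
      Module.finrank (ZMod 2) W + 𝒦.card :=
    (Submodule.finrank_mono hsup).trans ((Submodule.finrank_add_le_finrank_add_finrank W S).trans
      (Nat.add_le_add_left ((finrank_span_finset_le_card _).trans Finset.card_image_le) _))
  -- The dual rank formula `r*(T) + r(E) = r(E \ T) + |T|` now gives `r*(T) ≥ |T| - 𝒦.card`, and
  -- `hcount` finishes.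
  have hdual := G.cycleMatroid.eRk_dual_add_eRank T hTE
  rw [← Matroid.eRk_ground, Graph.cycleMatroid_ground,
    ← G.finrank_span_incVec (Set.toFinite _) subset_rfl,
    ← G.finrank_span_incVec (Set.toFinite _) Set.sdiff_subset, Set.encard_coe_eq_coe_finsetCard]
    at hdual
  have hne : G.cycleMatroid✶.eRk T ≠ ⊤ :=
    ((Matroid.eRk_le_encard _ _).trans_lt (by simp)).ne
  lift G.cycleMatroid✶.eRk T to ℕ using hne with k
  norm_cast at hdual ⊢
  change k + _ = Module.finrank (ZMod 2) W + _ at hdual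
  omega

end Graph

/-! ### Finite probability and the uniform random subset -/

namespace PMF

variable {Ω Ω' : Type*}

theorem toOuterMeasure_ne_top (p : PMF Ω) (A : Set Ω) : p.toOuterMeasure A ≠ ⊤ :=
  ((p.toOuterMeasure.mono (Set.subset_univ A)).trans_lt
    (((p.toOuterMeasure_apply_eq_one_iff Set.univ).2 (Set.subset_univ _)).trans_lt
      ENNReal.one_lt_top)).ne

theorem prob_mono (p : PMF Ω) {A B : Set Ω} (h : A ⊆ B) : p.prob A ≤ p.prob B :=
  ENNReal.toReal_mono (p.toOuterMeasure_ne_top B) (p.toOuterMeasure.mono h)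

theorem prob_nonneg (p : PMF Ω) (A : Set Ω) : 0 ≤ p.prob A := ENNReal.toReal_nonneg

theorem prob_univ (p : PMF Ω) : p.prob Set.univ = 1 := by
  rw [prob, (p.toOuterMeasure_apply_eq_one_iff Set.univ).2 (Set.subset_univ _), ENNReal.toReal_one]

theorem prob_empty (p : PMF Ω) : p.prob ∅ = 0 := by simp [prob]

theorem prob_eq_sum [Fintype Ω] (p : PMF Ω) (A : Set Ω) :
    p.prob A = ∑ a, (p a).toReal * A.indicator 1 a := by
  rw [prob, toOuterMeasure_apply_fintype, ENNReal.toReal_sum]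
  · refine Finset.sum_congr rfl fun a _ => ?_
    by_cases ha : a ∈ A <;> simp [ha]
  · intro a _
    by_cases ha : a ∈ A <;> simp [ha, p.apply_ne_top a]

theorem prob_map (p : PMF Ω) (f : Ω → Ω') (A : Set Ω') : (p.map f).prob A = p.prob (f ⁻¹' A) := by
  rw [prob, toOuterMeasure_map_apply, prob]

theorem prob_indepProd [Fintype Ω] (p : PMF Ω) (q : PMF Ω') (A : Set (Ω × Ω')) :
    (p.indepProd q).prob A = ∑ a, (p a).toReal * q.prob {b | (a, b) ∈ A} := by
  rw [prob, indepProd, toOuterMeasure_bind_apply, tsum_fintype, ENNReal.toReal_sum]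
  · refine Finset.sum_congr rfl fun a _ => ?_
    rw [ENNReal.toReal_mul, ← prob, prob_map]
    rfl
  · exact fun a _ => ENNReal.mul_ne_top (p.apply_ne_top a) (toOuterMeasure_ne_top _ _)

theorem prob_inter_add_prob_diff [Fintype Ω] (p : PMF Ω) (A B : Set Ω) :
    p.prob (A ∩ B) + p.prob (A \ B) = p.prob A := by
  simp only [prob_eq_sum, ← Finset.sum_add_distrib, ← mul_add]
  refine Finset.sum_congr rfl fun a _ => ?_
  by_cases ha : a ∈ A <;> by_cases hb : a ∈ B <;> simp [ha, hb]

theorem prob_uniformOfFintype_preimage [Fintype Ω] [Nonempty Ω] (σ : Ω ≃ Ω) (A : Set Ω) :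
    (uniformOfFintype Ω).prob (σ ⁻¹' A) = (uniformOfFintype Ω).prob A := by
  rw [prob_eq_sum, prob_eq_sum,
    ← Equiv.sum_comp σ fun a => (uniformOfFintype Ω a).toReal * A.indicator 1 a]
  simp only [uniformOfFintype_apply]
  rfl

variable {E : Type*}

/-- An event that does not depend on whether `j` belongs to a uniformly random set is halved by
the condition that `j` belongs to it. -/
theorem prob_uniform_inter_mem [Fintype (Set E)] (j : E) (A : Set (Set E))
    (hA : ∀ S, symmDiff S {j} ∈ A ↔ S ∈ A) :
    (uniformOfFintype (Set E)).prob (A ∩ {S | j ∈ S}) = (uniformOfFintype (Set E)).prob A / 2 := by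
  -- Toggling the membership of `j` preserves the uniform law and the event `A`, and it exchanges
  -- the sets containing `j` with those that do not.
  have hinv : Function.Involutive fun S : Set E => symmDiff S {j} := fun S =>
    symmDiff_symmDiff_cancel_right {j} S
  have h1 := prob_uniformOfFintype_preimage hinv.toPerm (A ∩ {S | j ∈ S})
  have h2 : hinv.toPerm ⁻¹' (A ∩ {S | j ∈ S}) = A \ {S | j ∈ S} := by
    ext S
    have h3 : j ∈ symmDiff S {j} ↔ j ∉ S := by simp [Set.mem_symmDiff]
    exact and_congr (hA S) h3
  rw [h2] at h1
  have h3 := prob_inter_add_prob_diff (uniformOfFintype (Set E)) A {S | j ∈ S}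
  linarith

theorem prob_uniform_mem [Fintype (Set E)] (i : E) :
    (uniformOfFintype (Set E)).prob {S | i ∈ S} = 1 / 2 := by
  have h := prob_uniform_inter_mem i Set.univ (by simp)
  rwa [Set.univ_inter, prob_univ] at h

theorem prob_uniform_mem_mem [Fintype (Set E)] {i j : E} (hij : i ≠ j) :
    (uniformOfFintype (Set E)).prob {S | i ∈ S ∧ j ∈ S} = 1 / 4 := by
  have h := prob_uniform_inter_mem j {S | i ∈ S} (by simp [Set.mem_symmDiff, hij])
  rw [prob_uniform_mem] at h
  rw [Set.ofPred_and]
  linarith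

/-- Lower bound for the probability that a uniformly random set contains `i` and avoids `C`. -/
theorem le_prob_uniform_mem_disjoint [Fintype (Set E)] {i : E} {C : Finset E} (hi : i ∉ C) :
    1 / 2 - (C.card : ℝ) / 4 ≤
      (uniformOfFintype (Set E)).prob {S | i ∈ S ∧ ∀ j ∈ C, j ∉ S} := by
  classical
  induction C using Finset.induction_on with
  | empty => simp [prob_uniform_mem]
  | insert j C hj ih =>
    rw [Finset.mem_insert, not_or] at hi
    -- Union bound: requiring `j ∉ S` as well costs at most the probability `1/4` that both `i` and
    -- `j` lie in `S`.
    have h1 := prob_inter_add_prob_diff (uniformOfFintype (Set E))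
      {S | i ∈ S ∧ ∀ j ∈ C, j ∉ S} {S | j ∈ S}
    have h2 : (uniformOfFintype (Set E)).prob ({S | i ∈ S ∧ ∀ j ∈ C, j ∉ S} ∩ {S | j ∈ S}) ≤
        (uniformOfFintype (Set E)).prob {S | i ∈ S ∧ j ∈ S} :=
      prob_mono _ fun S hS => ⟨hS.1.1, hS.2⟩
    have h3 : (uniformOfFintype (Set E)).prob ({S | i ∈ S ∧ ∀ j ∈ C, j ∉ S} \ {S | j ∈ S}) ≤
        (uniformOfFintype (Set E)).prob {S | i ∈ S ∧ ∀ k ∈ insert j C, k ∉ S} :=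
      prob_mono _ fun S hS => ⟨hS.1.1, fun k hk => (Finset.mem_insert.1 hk).elim
        (fun h => h ▸ hS.2) (hS.1.2 k)⟩
    rw [prob_uniform_mem_mem hi.1] at h2
    rw [Finset.card_insert_of_notMem hj, Nat.cast_add_one]
    linarith [ih hi.2]

end PMF

/-! ### Fractional covering by independent sets -/

namespace Matroid

variable {E : Type*}

/-- If every subset of `T` has rank at least `1 / k` times its size, then for all nonnegative
weights some independent subset of `T` has at least `1 / k` of the total weight. -/
theorem exists_indep_weight (M : Matroid E) (k : ℕ) (S : Finset E)
    (hS : ∀ S' ⊆ S, (S'.card : ℕ∞) ≤ k * M.eRk S') (w : E → ℝ) (hw : ∀ e ∈ S, 0 ≤ w e) :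
    ∃ B ⊆ S, M.Indep (B : Set E) ∧ ∑ e ∈ S, w e ≤ k * ∑ e ∈ B, w e := by
  classical
  induction S using Finset.strongInduction generalizing w with
  | H S ih =>
  rcases S.eq_empty_or_nonempty with rfl | hne
  · exact ⟨∅, subset_rfl, by simp, by simp⟩
  -- Subtract the minimum weight `w s` everywhere. Elements whose weight becomes 0 are dropped for
  -- the induction, and the independent set obtained is extended to a basis `B` of `S`. The rank
  -- hypothesis for `S`, in the form `|S| ≤ k |B|`, pays for the uniform amount subtracted.
  obtain ⟨s, hs, hmin⟩ := S.exists_min_image w hne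
  obtain ⟨B', hB'S, hB', hle⟩ := ih (S.filter fun e => w s < w e)
    (Finset.filter_ssubset.2 ⟨s, hs, lt_irrefl _⟩)
    (fun S' hS' => hS S' (hS'.trans (Finset.filter_subset _ _))) (fun e => w e - w s)
    (fun e he => sub_nonneg.2 (Finset.mem_filter.1 he).2.le)
  obtain ⟨B, hB, hB'B⟩ := hB'.subset_isBasis'_of_subset
    (show (B' : Set E) ⊆ S from fun e he => (Finset.mem_filter.1 (hB'S he)).1)
  lift B to Finset E using S.finite_toSet.subset hB.subset
  have hBS : B ⊆ S := by exact_mod_cast hB.subset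
  have hB'B : B' ⊆ B := by exact_mod_cast hB'B
  refine ⟨B, hBS, hB.indep, ?_⟩
  have hcard : (S.card : ℝ) ≤ k * B.card := by
    have h := hS S subset_rfl
    rw [← hB.encard_eq_eRk, Set.encard_coe_eq_coe_finsetCard] at h
    exact_mod_cast h
  have h1 : ∑ e ∈ S.filter (fun e => w s < w e), (w e - w s) = ∑ e ∈ S, (w e - w s) := by
    refine Finset.sum_filter_of_ne fun e he hne => ?_
    exact lt_of_le_of_ne (hmin e he) fun h => hne (by rw [h, sub_self])
  have h2 : ∑ e ∈ B', (w e - w s) ≤ ∑ e ∈ B, (w e - w s) :=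
    Finset.sum_le_sum_of_subset_of_nonneg hB'B fun e he _ => sub_nonneg.2 (hmin e (hBS he))
  rw [h1] at hle
  simp only [Finset.sum_sub_distrib, Finset.sum_const, nsmul_eq_mul] at hle h2
  have h3 := mul_le_mul_of_nonneg_left h2 (Nat.cast_nonneg (α := ℝ) k)
  have h4 := mul_le_mul_of_nonneg_right hcard (hw s hs)
  nlinarith

/-- If every subset of `T` has rank at least `1 / k` times its size, then some random independent
set contains each element of `T` with probability at least `1 / k`. -/
theorem exists_pmf_indep [Finite E] (M : Matroid E) {k : ℕ} (hk : 0 < k) (T : Finset E)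
    (hT : ∀ S ⊆ T, (S.card : ℕ∞) ≤ k * M.eRk S) :
    ∃ p : PMF (Set E), (∀ B ∈ p.support, M.Indep B) ∧
      ∀ e ∈ T, 1 / (k : ℝ) ≤ p.prob {B | e ∈ B} := by
  classical
  have := Fintype.ofFinite E
  have hk' : (0 : ℝ) < k := by exact_mod_cast hk
  -- `L` sends a distribution on independent sets to its vector of marginals. The claim is that the
  -- compact convex set `K` of such vectors meets the closed convex set `Q` of vectors that are at
  -- least `1 / k` on `T`; otherwise a linear functional separates them strictly.
  let L : ({B : Set E // M.Indep B} → ℝ) →ₗ[ℝ] (E → ℝ) :=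
    Matrix.toLin' (Matrix.of fun e (B : {B : Set E // M.Indep B}) => B.1.indicator 1 e)
  have hL : ∀ w e, L w e = ∑ B, w B * B.1.indicator 1 e := fun w e => by
    simp [L, Matrix.mulVec, dotProduct, mul_comm]
  let K := L '' stdSimplex ℝ {B : Set E // M.Indep B}
  let Q : Set (E → ℝ) := {y | ∀ e ∈ T, 1 / (k : ℝ) ≤ y e}
  have hKQ : ¬ Disjoint K Q := by
    intro hdisj
    have hQconv : Convex ℝ Q := by
      intro y hy z hz a b ha hb hab e he
      have h1 := mul_le_mul_of_nonneg_left (hy e he) ha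
      have h2 := mul_le_mul_of_nonneg_left (hz e he) hb
      simp only [Pi.add_apply, Pi.smul_apply, smul_eq_mul]
      calc 1 / (k : ℝ) = a * (1 / k) + b * (1 / k) := by rw [← add_mul, hab, one_mul]
        _ ≤ _ := add_le_add h1 h2
    have hQclosed : IsClosed Q := by
      have : Q = ⋂ e ∈ T, {y : E → ℝ | 1 / (k : ℝ) ≤ y e} := by ext; simp [Q]
      rw [this]
      exact isClosed_biInter fun e _ => isClosed_le continuous_const (continuous_apply e)
    obtain ⟨f, u, v, hfK, huv, hfQ⟩ := geometric_hahn_banach_compact_closed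
      ((convex_stdSimplex ℝ _).linear_image L)
      ((isCompact_stdSimplex ℝ _).image L.continuous_of_finiteDimensional) hQconv hQclosed hdisj
    let c : E → ℝ := fun e => f (Pi.single e 1)
    have hf : ∀ y, f y = ∑ e, y e * c e := by
      intro y
      conv_lhs => rw [pi_eq_sum_univ' y]
      rw [map_sum]
      refine Finset.sum_congr rfl fun e _ => ?_
      rw [map_smul, smul_eq_mul]
    let y₀ : E → ℝ := fun _ => 1 / (k : ℝ)
    have hy₀ : y₀ ∈ Q := fun e _ => le_rfl
    -- The step length is chosen so that `f` takes the value `v` at the shifted point, whereas `f >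
    -- v` on `Q`. As `Q` allows increases on `T` and arbitrary changes off `T`, this forces `c ≥ 0`
    -- on `T` and `c = 0` elsewhere.
    have hray : ∀ e, c e ≠ 0 → y₀ + ((v - f y₀) / c e) • Pi.single e 1 ∉ Q := by
      intro e he hQ
      have h := hfQ _ hQ
      rw [map_add, map_smul, smul_eq_mul, div_mul_cancel₀ _ he] at h
      linarith
    have hc : ∀ e ∈ T, 0 ≤ c e := by
      intro e he
      by_contra! hneg
      refine hray e hneg.ne fun a ha => ?_
      have h1 : 0 ≤ (v - f y₀) / c e := div_nonneg_of_nonpos (by linarith [hfQ _ hy₀]) hneg.le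
      have h2 : (0 : ℝ) ≤ (Pi.single e 1 : E → ℝ) a := by
        by_cases h : a = e
        · subst h; simp
        · simp [h]
      have h3 := mul_nonneg h1 h2
      simpa [y₀] using h3
    have hc0 : ∀ e ∉ T, c e = 0 := by
      intro e he
      by_contra hne
      refine hray e hne fun a ha => ?_
      have h : a ≠ e := fun h => he (h ▸ ha)
      simp [y₀, h]
    -- With `c` as weights, the indicator of `B` has `f`-value `c(B) ≥ c(T) / k = f y₀`. This
    -- contradicts the separation `c(B) < u < v < f y₀`.
    obtain ⟨B, hBT, hB, hle⟩ := M.exists_indep_weight k T hT c hc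
    have h1 := hfK _ ⟨_, single_mem_stdSimplex ℝ (⟨B, hB⟩ : {B : Set E // M.Indep B}), rfl⟩
    have h2 : f (L (Pi.single ⟨B, hB⟩ 1)) = ∑ e ∈ B, c e := by
      have hval : ∀ e, L (Pi.single ⟨B, hB⟩ 1) e = if e ∈ B then 1 else 0 := fun e => by
        rw [hL, Finset.sum_eq_single ⟨B, hB⟩ (fun B' _ h => by simp [h]) (by simp)]
        simp [Set.indicator_apply]
      rw [hf]
      simp [hval]
    have h3 : f y₀ = (∑ e ∈ T, c e) / k := by
      rw [hf, ← Finset.sum_subset (Finset.subset_univ T) fun e _ he => by rw [hc0 e he, mul_zero],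
        ← Finset.mul_sum]
      ring
    have h4 := hfQ _ hy₀
    rw [h2] at h1
    rw [h3, lt_div_iff₀ hk'] at h4
    nlinarith
  obtain ⟨_, ⟨w, hw, rfl⟩, hwQ⟩ := Set.not_disjoint_iff.1 hKQ
  let p : PMF {B : Set E // M.Indep B} := PMF.ofFintype (fun B => ENNReal.ofReal (w B)) (by
    rw [← ENNReal.ofReal_sum_of_nonneg fun B _ => hw.1 B, hw.2, ENNReal.ofReal_one])
  refine ⟨p.map Subtype.val, fun B hB => ?_, fun e he => ?_⟩
  · obtain ⟨B, -, rfl⟩ := (PMF.mem_support_map_iff _ _ _).1 hB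
    exact B.2
  · refine (hwQ e he).trans_eq ?_
    rw [PMF.prob_map, PMF.prob_eq_sum, hL]
    refine Finset.sum_congr rfl fun B _ => ?_
    rw [PMF.ofFintype_apply, ENNReal.toReal_ofReal (hw.1 B)]
    rfl

end Matroid

/-! ### Parallel classes and the contention resolution scheme -/

namespace Matroid

variable {E : Type*}

/-- Parallelism is encoded by equality of closures of singletons, an equivalence relation on the
whole type; loops and elements outside the ground set together form one class. -/
theorem exists_parallel_representatives (M : Matroid E) : ∃ rep : E → E,
    (∀ e, M.closure {rep e} = M.closure {e}) ∧
      ∀ e f, M.closure {e} = M.closure {f} → rep e = rep f := by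
  refine ⟨fun e => Set.rangeSplitting (fun a => M.closure {a})
    (Set.rangeFactorization (fun a => M.closure {a}) e), fun e => ?_, fun e f h => ?_⟩
  · exact Set.apply_rangeSplitting (fun a => M.closure {a}) _
  · exact congrArg _ (Subtype.ext h)

theorem isNonloop_of_closure_eq {M : Matroid E} {e f : E} (h : M.closure {e} = M.closure {f})
    (he : M.IsNonloop e) : M.IsNonloop f := by
  by_contra hf
  exact not_isNonloop_iff_closure.2 (h.trans (not_isNonloop_iff_closure.1 hf)) he

/-- Replacing elements of an independent set by parallel elements preserves independence. -/
theorem indep_of_injOn_of_closure_eq [Finite E] {M : Matroid E} {rep : E → E}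
    (hrep : ∀ e, M.closure {rep e} = M.closure {e}) {B I : Set E} (hB : M.Indep B)
    (hI : ∀ e ∈ I, rep e ∈ B) (hinj : Set.InjOn rep I) : M.Indep I := by
  rw [indep_iff_eRk_eq_encard_of_finite (Set.toFinite I)]
  refine le_antisymm (M.eRk_le_encard I) ?_
  have hind : M.Indep (rep '' I) := hB.subset (Set.image_subset_iff.2 hI)
  rw [← hinj.encard_image, ← hind.eRk_eq_encard, ← M.eRk_closure_eq I]
  refine M.eRk_mono ?_
  rintro _ ⟨e, he, rfl⟩
  have h1 : rep e ∈ M.closure {rep e} := by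
    refine M.mem_closure_self _ (hB.subset_ground (hI e he))
  rw [hrep e] at h1
  exact M.closure_subset_closure (Set.singleton_subset_iff.2 he) h1

/-- The sets that contain only elements of `S` represented in `B`, at most one from each parallel
class. -/
def partialTransversals (rep : E → E) (B S : Set E) : Set (Set E) :=
  {I | I ⊆ S ∧ (∀ e ∈ I, rep e ∈ B) ∧ Set.InjOn rep I}

theorem isFeasibleFamily_partialTransversals [Finite E] {M : Matroid E} {rep : E → E}
    (hrep : ∀ e, M.closure {rep e} = M.closure {e}) {B : Set E} (hB : M.Indep B) (S : Set E) :
    IsFeasibleFamily M (partialTransversals rep B S) where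
  empty_mem := ⟨Set.empty_subset _, by simp, Set.injOn_empty _⟩
  down_closed := fun _ hI _ hJI => ⟨hJI.trans hI.1, fun e he => hI.2.1 e (hJI he), hI.2.2.mono hJI⟩
  indep := fun _ hI => indep_of_injOn_of_closure_eq hrep hB hI.2.1 hI.2.2

/-- A parallel class has total weight at most one in the matroid polytope. -/
theorem sum_le_one_of_mem_polytope {M : Matroid E} {x : E → ℝ} (hx : x ∈ M.polytope) {i : E}
    {C : Finset E} (hCE : (C : Set E) ⊆ M.E) (hC : ∀ j ∈ C, M.closure {j} = M.closure {i}) :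
    ∑ j ∈ C, x j ≤ 1 := by
  refine (hx.2.2 C hCE).trans ?_
  have h1 : M.eRk C ≤ 1 := by
    refine (M.eRk_mono (b := M.closure {i}) fun j hj => ?_).trans
      ((M.eRk_closure_eq {i}).le.trans (M.eRk_singleton_le i))
    rw [← hC j hj]
    exact M.mem_closure_self j (hCE hj)
  have h2 := ENat.toNat_le_toNat h1 (by simp)
  exact_mod_cast h2

theorem isNonloop_of_mem_polytope {M : Matroid E} {x : E → ℝ} (hx : x ∈ M.polytope) {i : E}
    (hi : i ∈ M.E) (h0 : 0 < x i) : M.IsNonloop i := by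
  by_contra hn
  have h := hx.2.2 {i} (by simpa using hi)
  rw [Finset.coe_singleton, ((not_isNonloop_iff hi).1 hn).eRk_eq, Finset.sum_singleton] at h
  simp only [ENat.toNat_zero, Nat.cast_zero] at h
  linarith

/-- If every set of pairwise non-parallel non-loops has rank at least `1 / k` times its size,
then the matroid admits a `1 / (4 k)`-selectable PI-OCRS. -/
theorem exists_greedyPIOCRS_isSelectable [Finite E] (M : Matroid E) {k : ℕ} (hk : 0 < k)
    (hM : ∀ T : Finset E, (∀ e ∈ T, ∀ f ∈ T, M.Indep {e, f}) → (T.card : ℕ∞) ≤ k * M.eRk T) :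
    ∃ π : GreedyPIOCRS M, π.IsSelectable 1 (1 / (4 * k)) := by
  classical
  have := Fintype.ofFinite E
  have hk' : (0 : ℝ) < k := by exact_mod_cast hk
  obtain ⟨rep, hrep, hrep'⟩ := M.exists_parallel_representatives
  -- `T` is the ground set of the simplification of `M`, to which the rank hypothesis applies.
  let T : Finset E := (Finset.univ.filter fun e => M.IsNonloop e).image rep
  have hTmem : ∀ e ∈ T, M.IsNonloop e ∧ rep e = e := by
    intro e he
    obtain ⟨a, ha, rfl⟩ := Finset.mem_image.1 he
    exact ⟨isNonloop_of_closure_eq (hrep a).symm (Finset.mem_filter.1 ha).2, hrep' _ _ (hrep a)⟩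
  have hTindep : ∀ e ∈ T, ∀ f ∈ T, M.Indep {e, f} := by
    intro e he f hf
    by_cases hef : e = f
    · subst hef
      simpa using (hTmem e he).1
    · by_contra hn
      have h := ((hTmem e he).1.closure_eq_closure_iff_eq_or_dep (hTmem f hf).1).2 (Or.inr hn)
      exact hef ((hTmem e he).2.symm.trans ((hrep' _ _ h).trans (hTmem f hf).2))
  obtain ⟨p, hp, hpT⟩ := M.exists_pmf_indep hk T fun S hS =>
    hM S fun e he f hf => hTindep e (hS he) f (hS hf)
  let U : PMF (Set E) := PMF.uniformOfFintype (Set E)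
  -- `B` selects parallel classes, and the independent uniform set `S` thins each class. The law of
  -- the family does not depend on `D`.
  let q : PMF (Set (Set E)) := (p.indepProd U).map fun b => partialTransversals rep b.1 b.2
  have hq : ∀ F ∈ q.support, IsFeasibleFamily M F := by
    intro F hF
    obtain ⟨b, hb, rfl⟩ := (PMF.mem_support_map_iff _ _ _).1 hF
    obtain ⟨B, hB, hb⟩ := (PMF.mem_support_bind_iff _ _ _).1 hb
    obtain ⟨S, -, rfl⟩ := (PMF.mem_support_map_iff _ _ _).1 hb
    exact isFeasibleFamily_partialTransversals hrep (hp B hB) S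
  refine ⟨⟨fun _ => q, fun _ => hq⟩, ?_⟩
  intro x hx D hD i hi hpos
  rw [one_smul] at hx
  have hxi : D.prob {R | i ∈ R} = x i := hD.1 i
  rw [hxi] at hpos
  have hnl := isNonloop_of_mem_polytope hx hi hpos
  -- Within `R`, only the elements of `C` can block `i` once `i ∈ S` and `rep i ∈ B`.
  let C : Finset E := Finset.univ.filter fun j => j ≠ i ∧ M.closure {j} = M.closure {i}
  have hiC : i ∉ C := by simp [C]
  have hCsum : x i + ∑ j ∈ C, x j ≤ 1 := by
    rw [← Finset.sum_insert hiC]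
    have hcl : ∀ j ∈ insert i C, M.closure {j} = M.closure {i} := by
      intro j hj
      rcases Finset.mem_insert.1 hj with rfl | hj
      · rfl
      · exact (Finset.mem_filter.1 hj).2.2
    exact sum_le_one_of_mem_polytope hx
      (fun j hj => (isNonloop_of_closure_eq (hcl j hj).symm hnl).mem_ground) hcl
  have hP : 1 / (k : ℝ) ≤ p.prob {B | rep i ∈ B} :=
    hpT _ (Finset.mem_image_of_mem _ (by simpa using hnl))
  set P := p.prob {B | rep i ∈ B} with hPdef
  have hden : (D.indepProd q).prob {ω | i ∈ ω.1} = x i := by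
    rw [PMF.prob_indepProd, ← hxi, PMF.prob_eq_sum]
    refine Finset.sum_congr rfl fun R _ => ?_
    by_cases hR : i ∈ R
    · simp [hR, PMF.prob_univ]
    · simp [hR, PMF.prob_empty]
  -- The bound factors because `B` and `S` are independent. It may be negative when `R` contains
  -- many elements parallel to `i`; it is needed only on average over `R`.
  have hR : ∀ R : Set E, i ∈ R → P * (1 / 2 - ((C.filter fun j => j ∈ R).card : ℝ) / 4) ≤
      q.prob {F | ∀ I ⊆ R, I ∈ F → insert i I ∈ F} := by
    intro R hiR
    have hU := PMF.le_prob_uniform_mem_disjoint (i := i) (C := C.filter fun j => j ∈ R)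
      (fun h => hiC (Finset.mem_filter.1 h).1)
    rw [PMF.prob_map, PMF.prob_indepProd, hPdef, PMF.prob_eq_sum, Finset.sum_mul]
    refine Finset.sum_le_sum fun B _ => ?_
    rw [mul_assoc]
    refine mul_le_mul_of_nonneg_left ?_ ENNReal.toReal_nonneg
    by_cases hB : rep i ∈ B
    · rw [Set.indicator_of_mem (by exact hB), Pi.one_apply, one_mul]
      refine hU.trans (PMF.prob_mono _ fun S hS I hIR hI => ?_)
      obtain ⟨hiS, hdisj⟩ := hS
      refine ⟨Set.insert_subset hiS hI.1, ?_, ?_⟩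
      · rintro e (rfl | he)
        exacts [hB, hI.2.1 e he]
      · by_cases hiI : i ∈ I
        · rw [Set.insert_eq_of_mem hiI]
          exact hI.2.2
        rw [Set.injOn_insert hiI]
        refine ⟨hI.2.2, ?_⟩
        rintro ⟨j, hj, hji⟩
        have hcl : M.closure {j} = M.closure {i} := by rw [← hrep j, ← hrep i, hji]
        have hne : j ≠ i := fun h => hiI (h ▸ hj)
        exact hdisj j (by simp [C, hne, hcl, hIR hj]) (hI.1 hj)
    · rw [Set.indicator_of_notMem (by exact hB), zero_mul]
      exact PMF.prob_nonneg _ _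
  have hpair : ∀ j ∈ C, D.prob {R | i ∈ R ∧ j ∈ R} = x i * x j := by
    intro j hj
    rw [← hD.2 i j (Finset.mem_filter.1 hj).2.1.symm]
    simp [Set.insert_subset_iff]
  have hnum : P * (x i * (1 / 2 - (∑ j ∈ C, x j) / 4)) ≤
      (D.indepProd q).prob ({ω : Set E × Set (Set E) | ∀ I ⊆ ω.1, I ∈ ω.2 → insert i I ∈ ω.2} ∩
        {ω | i ∈ ω.1}) := by
    -- Expanding the cardinality as a sum of indicators leaves only the probabilities of `i ∈ R` and
    -- of `i, j ∈ R`, which are exactly those fixed by PI-consistency.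
    have hexp : x i * (1 / 2 - (∑ j ∈ C, x j) / 4) =
        ∑ R : Set E, (D R).toReal * ({R : Set E | i ∈ R}.indicator 1 R *
          (1 / 2 - ((C.filter fun j => j ∈ R).card : ℝ) / 4)) := by
      have h1 : x i * (1 / 2 - (∑ j ∈ C, x j) / 4) = x i / 2 - (∑ j ∈ C, x i * x j) / 4 := by
        rw [← Finset.mul_sum]; ring
      rw [h1, ← Finset.sum_congr rfl hpair, ← hxi]
      simp only [PMF.prob_eq_sum]
      rw [Finset.sum_comm, Finset.sum_div, Finset.sum_div, ← Finset.sum_sub_distrib]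
      refine Finset.sum_congr rfl fun R _ => ?_
      rw [← Finset.mul_sum, Finset.card_filter, Nat.cast_sum]
      by_cases hiR : i ∈ R
      · simp [hiR, Set.indicator_apply]
        ring
      · simp [hiR]
    rw [hexp, PMF.prob_indepProd, Finset.mul_sum]
    refine Finset.sum_le_sum fun R _ => ?_
    rw [mul_left_comm]
    refine mul_le_mul_of_nonneg_left ?_ ENNReal.toReal_nonneg
    by_cases hiR : i ∈ R
    · rw [Set.indicator_of_mem (by exact hiR), Pi.one_apply, one_mul]
      refine (hR R hiR).trans (PMF.prob_mono _ fun F hF => ⟨hF, hiR⟩)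
    · rw [Set.indicator_of_notMem (by exact hiR), zero_mul, mul_zero]
      exact PMF.prob_nonneg _ _
  rw [PMF.condProb, hden, le_div_iff₀ hpos]
  refine le_trans ?_ hnum
  -- Here `∑ j ∈ C, x j ≤ 1`, so the factor is at least `1/2 - 1/4`.
  have h1 : x i / 4 ≤ x i * (1 / 2 - (∑ j ∈ C, x j) / 4) := by nlinarith
  calc 1 / (4 * (k : ℝ)) * x i = 1 / k * (x i / 4) := by field_simp
    _ ≤ P * (x i * (1 / 2 - (∑ j ∈ C, x j) / 4)) :=
      mul_le_mul hP h1 (by positivity) (PMF.prob_nonneg _ _)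

end Matroid

/-- Every cographic matroid (on a finite ground set) admits a `1/12`-selectable PI-OCRS. -/
theorem mainTheorem3 {E : Type v} [Finite E] (M : Matroid E)
    (hM : Matroid.IsCographic.{u, v} M) :
    ∃ π : GreedyPIOCRS M, π.IsSelectable 1 (1 / 12) := by
  obtain ⟨V, G, rfl⟩ := hM
  have h := G.cycleMatroid✶.exists_greedyPIOCRS_isSelectable (k := 3) (by norm_num)
    G.card_le_three_mul_eRk_dual
  norm_num at h ⊢
  exact h
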